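/- For integers $k\ge 1$ and $r\ge 1$ let $\mathrm{M}(k,r)=\frac1r\sum_{d\mid r}\mu(r/d)\,k^d$ be the necklace polynomial, where $\mu$ is the Möbius function; its value is an integer. A cyclic two-dimensional array of shape $(M,N)$ (rows indexed modulo $M$, columns modulo $N$, $M,N\ge 1$) with entries from an alphabet of size $k$ is called an $(M,N;\,m,n)_k$-sub-perfect map if every $m\times n$ pattern over the alphabet occurs at most once in it as a (cyclically) contiguous block. Let $k_1,k_2\ge 2$ and $m,n\ge 2$ be integers with $|m-n|\le 2$. Put $$m'=\mathrm{M}(k_2^m,n)\bmod m,\qquad n'=\mathrm{M}(k_1^n,m)\bmod n,$$ $$m''=\begin{cases}|m'-1| & \text{if } m'<m-1,\\ 0 & \text{otherwise,}\end{cases}\qquad n''=\begin{cases}|n'-1| & \text{if } n'<n-1,\\ 0 & \text{otherwise.}\end{cases}$$ Then there exists an $(M,N;\,m,n)_{k_1k_2}$-sub-perfect map with $$M=m\cdot\bigl(\mathrm{M}(k_2^m,n)-m''\bigr)\ \ge\ m\cdot\bigl(\mathrm{M}(k_2^m,n)-\max(1,m-3)\bigr),$$ $$N=n\cdot\bigl(\mathrm{M}(k_1^n,m)-n''\bigr)\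 \ge\ n\cdot\bigl(\mathrm{M}(k_1^n,m)-\max(1,n-3)\bigr).$$ -/

import Mathlib

/-- The sum `∑_{d ∣ n} μ(n / d) k ^ d` is divisible by `n`, so that the division in
`necklacePoly` below is exact. -/
theorem dvd_sum_moebius_mul_pow (k n : ℕ) (hn : n ≠ 0) :
    (n : ℤ) ∣ ∑ d ∈ n.divisors, ArithmeticFunction.moebius (n / d) * (k : ℤ) ^ d := by
  have h1 : ∑ d ∈ n.divisors, ArithmeticFunction.moebius (n / d) * (k : ℤ) ^ d
      = ∑ e ∈ n.divisors, ArithmeticFunction.moebius e * (k : ℤ) ^ (n / e) := by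
    rw [← Nat.sum_div_divisors n
      (fun e => ArithmeticFunction.moebius e * (k : ℤ) ^ (n / e))]
    refine Finset.sum_congr rfl fun d hd => ?_
    rw [Nat.div_div_self (Nat.dvd_of_mem_divisors hd) hn]
  rw [h1, Int.natCast_dvd, Nat.dvd_iff_prime_pow_dvd_dvd]
  intro p j hp hj
  have := Fact.mk hp
  obtain ⟨b, q, hq, hbq⟩ := Nat.exists_eq_pow_mul_and_not_dvd hn p hp.ne_one
  have hjb : j ≤ b := by
    have hc : Nat.Coprime (p ^ j) q :=
      Nat.Coprime.pow_left j ((Nat.Prime.coprime_iff_not_dvd hp).2 hq)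
    rw [hbq] at hj
    exact (Nat.pow_dvd_pow_iff_le_right hp.one_lt).1 (hc.dvd_of_dvd_mul_right hj)
  refine (pow_dvd_pow p hjb).trans ?_
  rw [← Int.natCast_dvd]
  rcases b with _ | a
  · simp
  have hq0 : q ≠ 0 := by rintro rfl; simp at hq
  have hinj : Function.Injective (fun e : ℕ => p * e) :=
    fun x y h => Nat.eq_of_mul_eq_mul_left hp.pos h
  have hdisj : Disjoint q.divisors (q.divisors.image (fun e => p * e)) := by
    rw [Finset.disjoint_left]
    intro x hx hx'
    obtain ⟨y, _, rfl⟩ := Finset.mem_image.1 hx'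
    exact hq ((Dvd.intro _ rfl).trans (Nat.dvd_of_mem_divisors hx))
  have hsub : q.divisors ∪ q.divisors.image (fun e => p * e) ⊆ n.divisors := by
    intro x hx
    rw [Nat.mem_divisors]
    refine ⟨?_, hn⟩
    rw [hbq]
    rcases Finset.mem_union.1 hx with hx | hx
    · exact (Nat.dvd_of_mem_divisors hx).mul_left _
    · obtain ⟨y, hy, rfl⟩ := Finset.mem_image.1 hx
      exact mul_dvd_mul (dvd_pow_self p (by omega)) (Nat.dvd_of_mem_divisors hy)
  rw [← Finset.sum_subset hsub, Finset.sum_union hdisj, Finset.sum_image hinj.injOn,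
    ← Finset.sum_add_distrib]
  · refine Finset.dvd_sum fun e he => ?_
    have heq := Nat.dvd_of_mem_divisors he
    obtain ⟨r, rfl⟩ := heq
    have he0 : 0 < e := Nat.pos_of_ne_zero (by rintro rfl; simp at hq0)
    have hpe : Nat.Coprime p e :=
      (Nat.Prime.coprime_iff_not_dvd hp).2 fun h => hq (h.mul_right r)
    rw [ArithmeticFunction.isMultiplicative_moebius.map_mul_of_coprime hpe,
      ArithmeticFunction.moebius_apply_prime hp]
    have e1 : n / e = r * p * p ^ a := by
      rw [hbq]; exact Nat.div_eq_of_eq_mul_left he0 (by ring)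
    have e2 : n / (p * e) = r * p ^ a := by
      rw [hbq]; exact Nat.div_eq_of_eq_mul_left (Nat.mul_pos hp.pos he0) (by ring)
    rw [e1, e2]
    have h3 : ((p : ℕ) : ℤ) ∣ (k : ℤ) ^ (r * p) - (k : ℤ) ^ r := by
      rw [pow_mul, ← ZMod.intCast_zmod_eq_zero_iff_dvd]
      push_cast
      rw [ZMod.pow_card, sub_self]
    have h4 := dvd_sub_pow_of_dvd_sub h3 a
    rw [← pow_mul, ← pow_mul] at h4
    have h5 : ArithmeticFunction.moebius e * (k : ℤ) ^ (r * p * p ^ a)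
        + -1 * ArithmeticFunction.moebius e * (k : ℤ) ^ (r * p ^ a)
        = ArithmeticFunction.moebius e
          * ((k : ℤ) ^ (r * p * p ^ a) - (k : ℤ) ^ (r * p ^ a)) := by ring
    rw [h5]
    push_cast
    exact h4.mul_left _
  · intro x hx hx'
    have hxs : ¬ Squarefree x := by
      intro hs
      apply hx'
      have hxn := Nat.dvd_of_mem_divisors hx
      rw [hbq] at hxn
      rw [Finset.mem_union]
      by_cases hpx : p ∣ x
      · obtain ⟨y, rfl⟩ := hpx
        right
        refine Finset.mem_image.2 ⟨y, ?_, rfl⟩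
        have hpy : Nat.Coprime p y := Nat.coprime_of_squarefree_mul hs
        have hyn : y ∣ p ^ (a + 1) * q := (Dvd.intro_left p rfl).trans hxn
        exact Nat.mem_divisors.2
          ⟨(Nat.Coprime.pow_right (a + 1) hpy.symm).dvd_of_dvd_mul_left hyn, hq0⟩
      · left
        have hpx' : Nat.Coprime p x := (Nat.Prime.coprime_iff_not_dvd hp).2 hpx
        exact Nat.mem_divisors.2
          ⟨(Nat.Coprime.pow_right (a + 1) hpx'.symm).dvd_of_dvd_mul_left hxn, hq0⟩
    rw [ArithmeticFunction.moebius_eq_zero_of_not_squarefree hxs, zero_mul]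

/-- The necklace polynomial `M(k, n) = (1 / n) ∑_{d ∣ n} μ(n / d) k ^ d`.  The integer division
is exact by `dvd_sum_moebius_mul_pow`. -/
def necklacePoly (k n : ℕ) : ℤ :=
  (∑ d ∈ n.divisors, ArithmeticFunction.moebius (n / d) * (k : ℤ) ^ d) / (n : ℤ)

/-- The `(m, n)`-pattern `P` occurs in the cyclic array `A` of shape `(M, N)` with its upper left
corner at the position `(i, j)`; rows are indexed modulo `M` and columns modulo `N`. -/
def OccursAt {M N m n : ℕ} {σ : Type*} (A : Matrix (ZMod M) (ZMod N) σ)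
    (P : Matrix (Fin m) (Fin n) σ) (i : ZMod M) (j : ZMod N) : Prop :=
  ∀ (a : Fin m) (b : Fin n), A (i + ((a : ℕ) : ZMod M)) (j + ((b : ℕ) : ZMod N)) = P a b

/-- Every `(m, n)`-pattern occurs at most once in the cyclic array `A` of shape `(M, N)`. -/
def IsSubPerfectMap {M N : ℕ} {σ : Type*} (m n : ℕ) (A : Matrix (ZMod M) (ZMod N) σ) : Prop :=
  ∀ (P : Matrix (Fin m) (Fin n) σ) (i i' : ZMod M) (j j' : ZMod N),
    OccursAt A P i j → OccursAt A P i' j' → i = i' ∧ j = j'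

/-- There is an `(M, N; m, n)_k`-sub-perfect map. (`ZMod 0` is infinite, so `M` and `N` are
required to be positive.) -/
def ExistsSubPerfectMap (M N m n k : ℕ) : Prop :=
  0 < M ∧ 0 < N ∧ ∃ A : Matrix (ZMod M) (ZMod N) (Fin k), IsSubPerfectMap m n A

/-- `|a' - 1| * [a' < m - 1]` (Iverson bracket) with `a' = a mod m`. -/
def columnCorrection (a : ℤ) (m : ℕ) : ℤ :=
  |a % (m : ℤ) - 1| * (if a % (m : ℤ) < (m : ℤ) - 1 then 1 else 0)

/-! The map is a product of two cyclic arrays, one per factor of the alphabet. The first has `t`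
columns of height `m` over `k₁` letters, with windows of width `n` distinct even after vertical
rotation; it is repeated vertically. The second, over `k₂` letters, has the roles of rows and
columns exchanged. A pattern then determines its row modulo `m` and `s`, and its column modulo `t`
and `n`. If `m` is coprime to `s` and `n` to `t`, the Chinese remainder theorem gives the position.

The factors come from Eulerian circuits in a de Bruijn-like graph: edges are primitive necklaces of
length `m` over words of length `n`, and vertices are rotation classes of cyclic words over words of
length `n - 1`. Edges are counted by the necklace polynomial. The graph is balanced and connected,
and it has at least `m` loops, which may be omitted freely to make `t` congruent to `±1` modulo `n`.
The circuit passes through a constant, hence rotation-invariant, vertex, so its lift to an array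
closes up without a shift (`exists_cyclic_array_of_walk`). -/

/-! ### Eulerian circuits avoiding loops -/

/-- Composing a permutation with a swap of two points of different cycles merges these cycles. -/
theorem sameCycle_mul_swap {E : Type*} [Finite E] [DecidableEq E] {σ : Equiv.Perm E} {e e' : E}
    (h : ¬ σ.SameCycle e e') {x : E} (hx : σ.SameCycle e x ∨ σ.SameCycle e' x) :
    (σ * Equiv.swap e e').SameCycle e x := by
  set τ := σ * Equiv.swap e e' with hτ
  have he : τ e = σ e' := by simp [hτ]
  have he' : τ e' = σ e := by simp [hτ]
  have hne : ∀ y, y ≠ e → y ≠ e' → τ y = σ y := fun y h1 h2 => by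
    simp [hτ, Equiv.swap_apply_of_ne_of_ne h1 h2]
  have step : ∀ y, y ≠ e → y ≠ e' → τ.SameCycle e y → τ.SameCycle e (σ y) := fun y h1 h2 h3 => by
    rw [← hne y h1 h2]
    exact Equiv.Perm.sameCycle_apply_right.2 h3
  -- From `e`, `τ` enters the cycle of `e'` at `σ e'` and follows it to `e'`, whence it returns to
  -- `σ e`.
  have key' : ∀ i : ℕ, τ.SameCycle e ((σ ^ (i + 1)) e') := by
    intro i
    induction i with
    | zero =>
      rw [zero_add, pow_one, ← he]
      exact Equiv.Perm.sameCycle_apply_right.2 (Equiv.Perm.SameCycle.refl _ _)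
    | succ i ih =>
      rw [pow_succ', Equiv.Perm.mul_apply]
      by_cases h2 : (σ ^ (i + 1)) e' = e'
      · rw [h2, ← he]
        exact Equiv.Perm.sameCycle_apply_right.2 (Equiv.Perm.SameCycle.refl _ _)
      · refine step _ (fun h1 => h ?_) h2 ih
        exact Equiv.Perm.SameCycle.symm ⟨(i + 1 : ℕ), by rw [zpow_natCast, h1]⟩
  have hcyc' : ∀ y, σ.SameCycle e' y → τ.SameCycle e y := by
    intro y hy
    obtain ⟨i, hi⟩ := (Equiv.Perm.sameCycle_apply_left.2 hy).exists_nat_pow_eq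
    rw [← hi, ← Equiv.Perm.mul_apply, ← pow_succ]
    exact key' i
  have key : ∀ i : ℕ, τ.SameCycle e ((σ ^ i) e) := by
    intro i
    induction i with
    | zero => exact Equiv.Perm.SameCycle.refl _ _
    | succ i ih =>
      rw [pow_succ', Equiv.Perm.mul_apply]
      by_cases h1 : (σ ^ i) e = e
      · rw [h1, ← he']
        exact Equiv.Perm.sameCycle_apply_right.2 (hcyc' _ (Equiv.Perm.SameCycle.refl _ _))
      · refine step _ h1 (fun h2 => h ?_) ih
        exact ⟨(i : ℕ), by rw [zpow_natCast, h2]⟩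
  rcases hx with hx | hx
  · obtain ⟨i, rfl⟩ := hx.exists_nat_pow_eq
    exact key i
  · exact hcyc' _ hx

/-- A permutation that sends every edge of a directed graph to a successor of it can be changed
so that it fixes given loops. -/
theorem exists_perm_fixing_loops {E V : Type*} [DecidableEq E] (src tgt : E → V)
    (σ₀ : Equiv.Perm E) (h₀ : ∀ e, src (σ₀ e) = tgt e) (L : Finset E)
    (hL : ∀ e ∈ L, src e = tgt e) :
    ∃ σ : Equiv.Perm E, (∀ e, src (σ e) = tgt e) ∧ ∀ e ∈ L, σ e = e := by
  induction L using Finset.induction_on with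
  | empty => exact ⟨σ₀, h₀, by simp⟩
  | insert a L ha ih =>
    obtain ⟨σ, h1, h2⟩ := ih fun e he => hL e (Finset.mem_insert_of_mem he)
    have haa := hL a (Finset.mem_insert_self _ _)
    have hta : tgt (σ.symm a) = tgt a := by rw [← h1, Equiv.apply_symm_apply, haa]
    -- As `a` is a loop, it has the same target as its predecessor, so their successors may be
    -- exchanged.
    refine ⟨σ * Equiv.swap a (σ.symm a), fun e => ?_, fun e he => ?_⟩
    · rw [Equiv.Perm.mul_apply, h1]
      rcases eq_or_ne e a with rfl | he
      · rw [Equiv.swap_apply_left, hta]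
      rcases eq_or_ne e (σ.symm a) with rfl | he'
      · rw [Equiv.swap_apply_right, hta]
      rw [Equiv.swap_apply_of_ne_of_ne he he']
    · rcases Finset.mem_insert.1 he with rfl | he
      · simp
      · have hea : e ≠ a := fun h => ha (h ▸ he)
        have hea' : e ≠ σ.symm a := fun h => hea (by
          rw [Equiv.eq_symm_apply, h2 e he] at h; exact h)
        rw [Equiv.Perm.mul_apply, Equiv.swap_apply_of_ne_of_ne hea hea', h2 e he]

/-- Euler's theorem for directed graphs: the edges outside a set `L` of loops of a balanced
connected directed graph form one cycle of a permutation that sends edges to successors. -/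
theorem exists_perm_sameCycle_iff_notMem {E V : Type*} [Finite E] [DecidableEq E]
    (src tgt : E → V) (σ₀ : Equiv.Perm E) (h₀ : ∀ e, src (σ₀ e) = tgt e) (L : Finset E)
    (hL : ∀ e ∈ L, src e = tgt e) (e₀ : E) (he₀ : e₀ ∉ L)
    (hconn : ∀ e, Relation.ReflTransGen (fun u v => ∃ g, src g = u ∧ tgt g = v)
      (tgt e) (tgt e₀)) :
    ∃ σ : Equiv.Perm E, (∀ e, src (σ e) = tgt e) ∧ ∀ e, σ.SameCycle e₀ e ↔ e ∉ L := by
  obtain ⟨σ₁, h1, h2⟩ := exists_perm_fixing_loops src tgt σ₀ h₀ L hL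
  let P := {σ : Equiv.Perm E // (∀ e, src (σ e) = tgt e) ∧ ∀ e ∈ L, σ e = e}
  have : Nonempty P := ⟨⟨σ₁, h1, h2⟩⟩
  -- With the cycle through `e₀` as large as possible, no merging swap is left.
  obtain ⟨⟨σ, hσ, hσL⟩, hmax⟩ :=
    Finite.exists_max fun σ : P => {x | σ.1.SameCycle e₀ x}.ncard
  have hnot : ∀ e, σ.SameCycle e₀ e → e ∉ L := by
    intro e he heL
    have hfix : Function.IsFixedPt σ e := hσL e heL
    exact he₀ (he.symm.eq_of_left hfix ▸ heL)
  have hclosed : ∀ e, σ.SameCycle e₀ e → ∀ e' ∉ L, tgt e' = tgt e → σ.SameCycle e₀ e' := by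
    intro e he e' he' ht
    by_contra hcon
    have hee' : ¬ σ.SameCycle e e' := fun h => hcon (he.trans h)
    have hτ : (∀ x, src ((σ * Equiv.swap e e') x) = tgt x) ∧
        ∀ x ∈ L, (σ * Equiv.swap e e') x = x := by
      refine ⟨fun x => ?_, fun x hx => ?_⟩
      · rw [Equiv.Perm.mul_apply, hσ]
        rcases eq_or_ne x e with rfl | hx
        · rw [Equiv.swap_apply_left, ht]
        rcases eq_or_ne x e' with rfl | hx'
        · rw [Equiv.swap_apply_right, ht]
        rw [Equiv.swap_apply_of_ne_of_ne hx hx']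
      · rw [Equiv.Perm.mul_apply, Equiv.swap_apply_of_ne_of_ne (ne_of_mem_of_not_mem hx (hnot e he))
          (ne_of_mem_of_not_mem hx he'), hσL x hx]
    have hlt : {x | σ.SameCycle e₀ x}.ncard
        < {x | (σ * Equiv.swap e e').SameCycle e₀ x}.ncard := by
      have h0 : (σ * Equiv.swap e e').SameCycle e₀ e :=
        (sameCycle_mul_swap hee' (Or.inl he.symm)).symm
      refine Set.ncard_lt_ncard ⟨fun x hx => ?_, fun hsub => hcon (hsub ?_)⟩ (Set.toFinite _)
      · exact h0.trans (sameCycle_mul_swap hee' (Or.inl (he.symm.trans hx)))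
      · exact h0.trans (sameCycle_mul_swap hee' (Or.inr (Equiv.Perm.SameCycle.refl _ _)))
    exact absurd (hmax ⟨_, hτ⟩) (not_le.2 hlt)
  refine ⟨σ, hσ, fun e => ⟨hnot e, fun he => ?_⟩⟩
  -- Induction backwards along a path to `tgt e₀`: an edge of the path outside `L` lies on the
  -- cycle, hence so does its predecessor, which ends at `u`. Edges in `L` do not move the vertex.
  have hgood : ∀ u, Relation.ReflTransGen (fun u v => ∃ g, src g = u ∧ tgt g = v) u (tgt e₀) →
      ∀ f ∉ L, tgt f = u → σ.SameCycle e₀ f := by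
    intro u hu
    induction hu using Relation.ReflTransGen.head_induction_on with
    | refl => exact hclosed e₀ (Equiv.Perm.SameCycle.refl _ _)
    | head hg _ ih =>
      obtain ⟨g, rfl, rfl⟩ := hg
      intro f hf hfg
      by_cases hgL : g ∈ L
      · exact ih f hf (hfg.trans (hL g hgL))
      · refine hclosed (σ.symm g) ?_ f hf ?_
        · rw [← Equiv.Perm.sameCycle_apply_right, Equiv.apply_symm_apply]
          exact ih g hgL rfl
        · rw [hfg, ← hσ, Equiv.apply_symm_apply]
  exact hgood _ (hconn e) e he rfl

/-- The edges outside a set `L` of loops of a balanced connected directed graph can be traversed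
by a closed walk without repetition. -/
theorem exists_eulerian_sequence {E V : Type*} [Fintype E] [DecidableEq E]
    (src tgt : E → V) (σ₀ : Equiv.Perm E) (h₀ : ∀ e, src (σ₀ e) = tgt e) (L : Finset E)
    (hL : ∀ e ∈ L, src e = tgt e) (e₀ : E) (he₀ : e₀ ∉ L)
    (hconn : ∀ e, Relation.ReflTransGen (fun u v => ∃ g, src g = u ∧ tgt g = v)
      (tgt e) (tgt e₀)) :
    ∃ (t : ℕ) (u : ℕ → E), 0 < t ∧ t + L.card = Fintype.card E ∧ src (u 0) = tgt e₀ ∧ u t = u 0 ∧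
      (∀ j, src (u (j + 1)) = tgt (u j)) ∧ Set.InjOn u (Set.Iio t) := by
  obtain ⟨σ, hσ, hcyc⟩ :=
    exists_perm_sameCycle_iff_notMem src tgt σ₀ h₀ L hL e₀ he₀ hconn
  obtain ⟨e₁, he₁⟩ : ∃ e₁, e₁ = σ e₀ := ⟨_, rfl⟩
  have hcyc₁ : ∀ e, σ.SameCycle e₁ e ↔ e ∉ L := fun e => by
    rw [he₁, Equiv.Perm.sameCycle_apply_left, hcyc]
  have hper : e₁ ∈ Function.periodicPts σ :=
    Function.mk_mem_periodicPts (orderOf_pos σ) (by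
      rw [Function.IsPeriodicPt, Function.IsFixedPt, Equiv.Perm.iterate_eq_pow, pow_orderOf_eq_one,
        Equiv.Perm.one_apply])
  have hpos := Function.minimalPeriod_pos_of_mem_periodicPts hper
  refine ⟨Function.minimalPeriod σ e₁, fun j => σ^[j] e₁, hpos, ?_, he₁ ▸ hσ e₀,
    Function.iterate_minimalPeriod, fun j => ?_, Function.iterate_injOn_Iio_minimalPeriod⟩
  · have himg : (Finset.range (Function.minimalPeriod σ e₁)).image (fun j => σ^[j] e₁) = Lᶜ := by
      ext x
      rw [Finset.mem_compl, ← hcyc₁, Finset.mem_image]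
      constructor
      · rintro ⟨j, _, rfl⟩
        exact ⟨j, by rw [zpow_natCast, Equiv.Perm.iterate_eq_pow]⟩
      · intro hx
        obtain ⟨i, rfl⟩ := hx.exists_nat_pow_eq
        refine ⟨i % Function.minimalPeriod σ e₁, Finset.mem_range.2 (Nat.mod_lt _ hpos), ?_⟩
        rw [Function.iterate_mod_minimalPeriod_eq, Equiv.Perm.iterate_eq_pow]
    have hcard := congrArg Finset.card himg
    rw [Finset.card_image_of_injOn, Finset.card_range, Finset.card_compl] at hcard
    · have := Finset.card_le_univ L
      omega
    · intro a ha b hb hab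
      exact Function.iterate_injOn_Iio_minimalPeriod (by simpa using ha) (by simpa using hb) hab
  · simp only [Function.iterate_succ_apply']
    exact hσ _

/-! ### Primitive words and the count of primitive necklaces -/

/-- A cyclic word of length `m` is primitive if it differs from all its nontrivial rotations. -/
def IsPrimitiveWord {m : ℕ} {K : Type*} (f : ZMod m → K) : Prop :=
  ∀ a, (fun i => f (i + a)) = f → a = 0

/-- Two cyclic words are equivalent if they are rotations of each other. -/
def rotationSetoid (m : ℕ) (K : Type*) : Setoid (ZMod m → K) where
  r f g := ∃ a, g = fun i => f (i + a)
  iseqv :=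
    { refl := fun f => ⟨0, by simp⟩
      symm := by
        rintro f _ ⟨a, rfl⟩
        exact ⟨-a, by simp⟩
      trans := by
        rintro f _ _ ⟨a, rfl⟩ ⟨b, rfl⟩
        exact ⟨b + a, by simp [add_assoc]⟩ }

/-- Primitive necklaces: primitive cyclic words up to rotation. -/
abbrev PrimitiveNecklace (m : ℕ) (K : Type*) : Type _ :=
  Quotient ((rotationSetoid m K).comap (Subtype.val : {f : ZMod m → K // IsPrimitiveWord f} → _))

/-- Rotation of a cyclic word by one position. -/
def rotateWord {m : ℕ} {K : Type*} (f : ZMod m → K) : ZMod m → K := fun i => f (i + 1)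

theorem rotateWord_iterate {m : ℕ} {K : Type*} (f : ZMod m → K) (a : ℕ) :
    rotateWord^[a] f = fun i => f (i + a) := by
  induction a with
  | zero => simp
  | succ a ih =>
    rw [Function.iterate_succ_apply', ih]
    funext i
    simp [rotateWord, add_comm, add_left_comm]

theorem isPeriodicPt_rotateWord {m : ℕ} {K : Type*} (f : ZMod m → K) :
    Function.IsPeriodicPt rotateWord m f := by
  rw [Function.IsPeriodicPt, Function.IsFixedPt, rotateWord_iterate]
  simp

theorem isPrimitiveWord_iff {m : ℕ} [NeZero m] {K : Type*} (f : ZMod m → K) :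
    IsPrimitiveWord f ↔ Function.minimalPeriod rotateWord f = m := by
  constructor
  · intro h
    refine Nat.dvd_antisymm (isPeriodicPt_rotateWord f).minimalPeriod_dvd ?_
    rw [← ZMod.natCast_eq_zero_iff]
    refine h _ ?_
    rw [← rotateWord_iterate, Function.iterate_minimalPeriod]
  · intro h a ha
    have hp : Function.IsPeriodicPt rotateWord a.val f := by
      rw [Function.IsPeriodicPt, Function.IsFixedPt, rotateWord_iterate]
      simpa using ha
    have := hp.minimalPeriod_dvd
    rw [h] at this
    rw [← ZMod.natCast_zmod_val a]
    exact (ZMod.natCast_eq_zero_iff _ _).2 this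

theorem minimalPeriod_rotateWord_comp_castHom {d m : ℕ} (h : d ∣ m) {K : Type*} (g : ZMod d → K) :
    Function.minimalPeriod rotateWord (g ∘ ZMod.castHom h (ZMod d)) =
      Function.minimalPeriod rotateWord g := by
  rw [Function.minimalPeriod_eq_minimalPeriod_iff]
  intro a
  simp only [Function.IsPeriodicPt, Function.IsFixedPt, rotateWord_iterate]
  constructor
  · intro hg
    funext i
    obtain ⟨j, rfl⟩ := ZMod.castHom_surjective h i
    simpa [-ZMod.castHom_apply] using congrFun hg j
  · intro hg
    funext i
    simpa [-ZMod.castHom_apply] using congrFun hg (ZMod.castHom h (ZMod d) i)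

theorem exists_eq_comp_castHom {d m : ℕ} [NeZero d] [NeZero m] (h : d ∣ m) {K : Type*}
    (f : ZMod m → K) (hf : Function.IsPeriodicPt rotateWord d f) :
    ∃ g : ZMod d → K, g ∘ ZMod.castHom h (ZMod d) = f := by
  refine ⟨fun j => f (j.val : ℕ), ?_⟩
  funext i
  have hq : ∀ q r : ℕ, f ((r + d * q : ℕ) : ZMod m) = f (r : ZMod m) := by
    intro q r
    have := (hf.mul_const q)
    rw [Function.IsPeriodicPt, Function.IsFixedPt, rotateWord_iterate] at this
    simpa using congrFun this r
  have hi : ((ZMod.castHom h (ZMod d) i).val : ℕ) = i.val % d := by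
    conv_lhs => rw [← ZMod.natCast_zmod_val i]
    rw [map_natCast, ZMod.val_natCast]
  simp only [Function.comp_apply]
  rw [hi, ← hq (i.val / d), Nat.mod_add_div, ZMod.natCast_zmod_val]

/-- Words of length `m` are sorted by minimal period `d`; those of period `d` are the periodic
extensions of primitive words of length `d`. -/
theorem sum_card_isPrimitiveWord {K : Type*} [Fintype K] (m : ℕ) (hm : 0 < m) :
    ∑ d ∈ m.divisors, Nat.card {f : ZMod d → K // IsPrimitiveWord f} = Fintype.card K ^ m := by
  classical
  have : NeZero m := ⟨hm.ne'⟩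
  have h1 : Fintype.card K ^ m = (Finset.univ : Finset (ZMod m → K)).card := by
    rw [Finset.card_univ, Fintype.card_fun, ZMod.card]
  rw [h1, Finset.card_eq_sum_card_fiberwise (t := m.divisors)
    (f := fun f => Function.minimalPeriod rotateWord f)
    (fun f _ => Nat.mem_divisors.2 ⟨(isPeriodicPt_rotateWord f).minimalPeriod_dvd, hm.ne'⟩)]
  refine Finset.sum_congr rfl fun d hd => ?_
  have hdm := Nat.dvd_of_mem_divisors hd
  have : NeZero d := ⟨(Nat.pos_of_mem_divisors hd).ne'⟩
  rw [Nat.card_eq_fintype_card, Fintype.card_subtype,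
    ← Finset.card_image_of_injective _ (f := fun g : ZMod d → K => g ∘ ZMod.castHom hdm (ZMod d))
      (ZMod.castHom_surjective hdm).injective_comp_right]
  congr 1
  ext f
  simp only [Finset.mem_image, Finset.mem_filter, Finset.mem_univ, true_and, isPrimitiveWord_iff]
  constructor
  · rintro ⟨g, hg, rfl⟩
    rw [minimalPeriod_rotateWord_comp_castHom, hg]
  · intro hf
    obtain ⟨g, rfl⟩ := exists_eq_comp_castHom hdm f
      (hf ▸ Function.isPeriodicPt_minimalPeriod _ _)
    exact ⟨g, (minimalPeriod_rotateWord_comp_castHom hdm g).symm.trans hf, rfl⟩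

/-- By primitivity, the `m` rotations of a representative are distinct. -/
theorem card_isPrimitiveWord_eq {m : ℕ} {K : Type*} :
    Nat.card {f : ZMod m → K // IsPrimitiveWord f} = Nat.card (PrimitiveNecklace m K) * m := by
  suffices h : Nat.card (PrimitiveNecklace m K × ZMod m) =
      Nat.card {f : ZMod m → K // IsPrimitiveWord f} by
    rw [← h, Nat.card_prod, Nat.card_zmod]
  refine Nat.card_congr (Equiv.ofBijective (fun x => ⟨fun i => (Quotient.out x.1).1 (i + x.2), ?_⟩)
    ⟨?_, ?_⟩)
  · intro a ha
    refine (Quotient.out x.1).2 a ?_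
    funext i
    have := congrFun ha (i - x.2)
    simp only [sub_add_cancel] at this
    rwa [show i - x.2 + a + x.2 = i + a by abel] at this
  · rintro ⟨e, a⟩ ⟨e', a'⟩ h
    have h : (fun i => (Quotient.out e).1 (i + (a - a'))) = (Quotient.out e').1 := by
      funext i
      have := congrFun (congrArg Subtype.val h) (i - a')
      simp only [sub_add_cancel] at this
      rw [← this, show i - a' + a = i + (a - a') by abel]
    have hee : e = e' := by
      rw [← Quotient.out_eq e, ← Quotient.out_eq e']
      exact Quotient.sound ⟨a - a', h.symm⟩
    subst hee
    have := (Quotient.out e).2 (a - a') h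
    rw [sub_eq_zero.1 this]
  · intro f
    obtain ⟨a, ha⟩ := Quotient.mk_out (s := (rotationSetoid m K).comap Subtype.val) f
    exact ⟨(Quotient.mk _ f, a), Subtype.ext ha.symm⟩

/-- The necklace polynomial counts primitive necklaces. -/
theorem card_primitiveNecklace {K : Type*} [Fintype K] (m : ℕ) (hm : 0 < m) :
    (Nat.card (PrimitiveNecklace m K) : ℤ) = necklacePoly (Fintype.card K) m := by
  have h := (ArithmeticFunction.sum_eq_iff_sum_mul_moebius_eq (R := ℤ)
    (f := fun d => (Nat.card {f : ZMod d → K // IsPrimitiveWord f} : ℤ))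
    (g := fun d => (Fintype.card K : ℤ) ^ d)).1
    (fun d hd => by exact_mod_cast sum_card_isPrimitiveWord d hd) m hm
  simp only [Int.cast_id] at h
  rw [Nat.sum_divisorsAntidiagonal' (f := fun x y =>
    ArithmeticFunction.moebius x * (Fintype.card K : ℤ) ^ y)] at h
  rw [necklacePoly, h, card_isPrimitiveWord_eq, Nat.cast_mul, Int.mul_ediv_cancel _ (by exact_mod_cast hm.ne')]

/-! ### The graph of primitive necklaces -/

theorem IsPrimitiveWord.of_comp {m : ℕ} {K K' : Type*} (φ : K → K') {f : ZMod m → K}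
    (h : IsPrimitiveWord (φ ∘ f)) : IsPrimitiveWord f := by
  intro a ha
  refine h a ?_
  funext i
  exact congrArg φ (congrFun ha i)

theorem IsPrimitiveWord.rotate {m : ℕ} {K : Type*} {f : ZMod m → K}
    (h : IsPrimitiveWord f) (c : ZMod m) : IsPrimitiveWord fun i => f (i + c) := by
  intro a ha
  refine h a ?_
  funext i
  have := congrFun ha (i - c)
  simp only [sub_add_cancel] at this
  rwa [show i - c + a + c = i + a by abel] at this

/-- The rotation class of the image of a primitive necklace under a map of the alphabets. -/
def PrimitiveNecklace.map {m : ℕ} {K K' : Type*} (φ : K → K') :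
    PrimitiveNecklace m K → Quotient (rotationSetoid m K') :=
  Quotient.map' (fun f => φ ∘ f.1) (by
    rintro f g ⟨a, ha⟩
    exact ⟨a, by rw [ha]; rfl⟩)

/-- The primitive necklace of a primitive word. -/
def IsPrimitiveWord.necklace {m : ℕ} {K : Type*} {f : ZMod m → K} (h : IsPrimitiveWord f) :
    PrimitiveNecklace m K :=
  Quotient.mk _ ⟨f, h⟩

theorem IsPrimitiveWord.map_necklace {m : ℕ} {K K' : Type*} (φ : K → K') {f : ZMod m → K}
    (h : IsPrimitiveWord f) :
    h.necklace.map φ = Quotient.mk (rotationSetoid m K') (φ ∘ f) := rfl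

theorem IsPrimitiveWord.necklace_eq_iff {m : ℕ} {K : Type*} {f g : ZMod m → K}
    (hf : IsPrimitiveWord f) (hg : IsPrimitiveWord g) :
    hf.necklace = hg.necklace ↔ ∃ a, g = fun i => f (i + a) :=
  Quotient.eq

theorem PrimitiveNecklace.exists_rep {m : ℕ} {K : Type*} (e : PrimitiveNecklace m K) :
    ∃ (f : ZMod m → K) (h : IsPrimitiveWord f), h.necklace = e :=
  ⟨_, (Quotient.out e).2, Quotient.out_eq e⟩

/-- A bijection of alphabets acts on primitive necklaces. -/
def PrimitiveNecklace.congr {m : ℕ} {K K' : Type*} (κ : K ≃ K') :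
    PrimitiveNecklace m K ≃ PrimitiveNecklace m K' :=
  Quotient.congr
    (Equiv.subtypeEquiv ((Equiv.refl (ZMod m)).arrowCongr κ) fun f =>
      ⟨fun h => IsPrimitiveWord.of_comp κ.symm (by convert h using 1; funext i; simp),
        fun h => IsPrimitiveWord.of_comp κ h⟩)
    (by
      rintro ⟨f, hf⟩ ⟨g, hg⟩
      refine exists_congr fun a => ?_
      constructor
      · intro h
        funext i
        exact congrArg κ (congrFun h i)
      · intro h
        funext i
        exact κ.injective (congrFun h i))

theorem PrimitiveNecklace.map_congr {m : ℕ} {K K' K'' : Type*} (κ : K ≃ K') (φ : K' → K'')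
    (e : PrimitiveNecklace m K) : (congr κ e).map φ = e.map (φ ∘ κ) := by
  obtain ⟨f, h, rfl⟩ := e.exists_rep
  rfl

/-- The first `p` letters of each of the rows. -/
def PrimitiveNecklace.source {m p : ℕ} {C : Type*} (e : PrimitiveNecklace m (Fin (p + 1) → C)) :
    Quotient (rotationSetoid m (Fin p → C)) :=
  e.map fun v b => v b.castSucc

/-- The last `p` letters of each of the rows. -/
def PrimitiveNecklace.target {m p : ℕ} {C : Type*} (e : PrimitiveNecklace m (Fin (p + 1) → C)) :
    Quotient (rotationSetoid m (Fin p → C)) :=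
  e.map fun v b => v b.succ

/-- Balance of the graph: cyclically shifting the columns of a window is a bijection of the edges
that sends each edge to a successor. -/
theorem PrimitiveNecklace.source_congr_finRotate {m p : ℕ} {C : Type*}
    (e : PrimitiveNecklace m (Fin (p + 1) → C)) :
    (congr ((finRotate (p + 1)).symm.arrowCongr (Equiv.refl C)) e).source = e.target := by
  rw [source, map_congr, target]
  congr 1
  funext v b
  simp

theorem eq_const_of_mk_eq {m : ℕ} {K : Type*} {f : ZMod m → K} {z : K}
    (h : Quotient.mk (rotationSetoid m K) f = Quotient.mk _ fun _ => z) : f = fun _ => z := by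
  obtain ⟨a, ha⟩ := Quotient.exact h
  funext i
  have := congrFun ha (i - a)
  simpa using this.symm

/-- Adjacent edges overlap only up to rotation; rotating the representative of the second makes the
overlap exact. -/
theorem exists_lift_succ {m p : ℕ} {C : Type*} {f : ZMod m → Fin (p + 1) → C}
    (hf : IsPrimitiveWord f) (e : PrimitiveNecklace m (Fin (p + 1) → C))
    (he : e.source = hf.necklace.target) :
    ∃ (g : ZMod m → Fin (p + 1) → C) (hg : IsPrimitiveWord g), hg.necklace = e ∧
      ∀ i (b : Fin p), g i b.castSucc = f i b.succ := by
  obtain ⟨g, hg, rfl⟩ := e.exists_rep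
  obtain ⟨a, ha⟩ := Quotient.exact he
  refine ⟨_, hg.rotate a, ?_, fun i b => ?_⟩
  · exact ((hg.necklace_eq_iff (hg.rotate a)).2 ⟨a, rfl⟩).symm
  · exact (congrFun (congrFun ha i) b).symm

/-- A closed walk in the graph of primitive necklaces that passes through a vertex invariant
under rotation is the sequence of the windows of a cyclic array. -/
theorem exists_cyclic_array_of_walk {m p t : ℕ} {C : Type*}
    (u : ℕ → PrimitiveNecklace m (Fin (p + 1) → C))
    (hu : ∀ j, (u (j + 1)).source = (u j).target) (z : Fin p → C)
    (hz : (u 0).source = Quotient.mk _ fun _ => z) (ht : 0 < t) (hut : u t = u 0)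
    (hinj : Set.InjOn u (Set.Iio t)) :
    ∃ x : ZMod t → ZMod m → C, ∀ j j' i i',
      (∀ b ≤ p, ∀ a : ZMod m, x (j + (b : ℕ)) (i + a) = x (j' + (b : ℕ)) (i' + a)) →
        j = j' ∧ i = i' := by
  have : NeZero t := ⟨ht.ne'⟩
  let R (j : ℕ) := {f : ZMod m → Fin (p + 1) → C // ∃ h : IsPrimitiveWord f, h.necklace = u j}
  have hstep : ∀ j (f : R j), ∃ g : R (j + 1), ∀ i (b : Fin p),
      g.1 i b.castSucc = f.1 i b.succ := by
    rintro j ⟨f, hf, hfu⟩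
    obtain ⟨g, hg, hgu, h⟩ := exists_lift_succ hf (u (j + 1)) (by rw [hfu, hu])
    exact ⟨⟨g, hg, hgu⟩, h⟩
  choose next hnext using hstep
  obtain ⟨f₀, hf₀, hfu₀⟩ := (u 0).exists_rep
  let w : ∀ j, R j := fun j => Nat.rec (motive := R) ⟨f₀, hf₀, hfu₀⟩ next j
  have hw : ∀ j i (b : Fin p), (w (j + 1)).1 i b.castSucc = (w j).1 i b.succ :=
    fun j => hnext j (w j)
  have hw0 : ∀ i (b : Fin p), (w 0).1 i b.castSucc = z b := by
    intro i b
    rw [← hfu₀] at hz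
    exact congrFun (congrFun (eq_const_of_mk_eq hz) i) b
  have hwt : ∀ j, j + 1 = t → ∀ i (b : Fin p), (w j).1 i b.succ = z b := by
    intro j hj i b
    obtain ⟨h, hj'⟩ := (w j).2
    have h1 : h.necklace.target = Quotient.mk _ fun _ => z := by
      rw [hj', ← hu, hj, hut, hz]
    exact congrFun (congrFun (eq_const_of_mk_eq h1) i) b
  -- At the wrap-around both overlaps are the constant word `z` itself, not merely rotations of it.
  have hcyc : ∀ j i (b : Fin p),
      (w ((j + 1) % t)).1 i b.castSucc = (w (j % t)).1 i b.succ := by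
    intro j i b
    by_cases hj : j % t + 1 = t
    · have h0 : (j + 1) % t = 0 := by
        rw [← Nat.mod_add_mod, hj, Nat.mod_self]
      rw [h0, hw0, hwt _ hj]
    · have h0 : (j + 1) % t = j % t + 1 := by
        rw [← Nat.mod_add_mod, Nat.mod_eq_of_lt]
        have := Nat.mod_lt j ht
        omega
      rw [h0, hw]
  have hwin : ∀ (b : ℕ) (hb : b < p + 1) (j : ℕ) i,
      (w (j % t)).1 i ⟨b, hb⟩ = (w ((j + b) % t)).1 i 0 := by
    intro b
    induction b with
    | zero => intro hb j i; rfl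
    | succ b ih =>
      intro hb j i
      rw [show j + (b + 1) = j + 1 + b by ring, ← ih (by omega)]
      exact (hcyc j i ⟨b, by omega⟩).symm
  refine ⟨fun j i => (w j.val).1 i 0, fun j j' i i' h => ?_⟩
  have hx : ∀ (j : ZMod t) (i : ZMod m) (b : ℕ) (hb : b < p + 1),
      (w (j + (b : ℕ)).val).1 i 0 = (w j.val).1 i ⟨b, hb⟩ := by
    intro j i b hb
    have := hwin b hb j.val i
    rw [Nat.mod_eq_of_lt (ZMod.val_lt j)] at this
    rw [this, ZMod.val_add, ZMod.val_natCast, Nat.add_mod_mod]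
  have heq : ∀ a, (w j.val).1 (i + a) = (w j'.val).1 (i' + a) := by
    intro a
    funext ⟨b, hb⟩
    rw [← hx j _ b hb, ← hx j' _ b hb]
    exact h b (by omega) a
  obtain ⟨h1, h1u⟩ := (w j.val).2
  obtain ⟨h2, h2u⟩ := (w j'.val).2
  have hjj : j = j' := by
    apply ZMod.val_injective t
    apply hinj (ZMod.val_lt j) (ZMod.val_lt j')
    rw [← h1u, ← h2u, IsPrimitiveWord.necklace_eq_iff]
    refine ⟨i - i', ?_⟩
    funext a
    rw [show a + (i - i') = i + (a - i') by abel, heq, add_sub_cancel]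
  subst hjj
  refine ⟨rfl, ?_⟩
  rw [← sub_eq_zero]
  refine h1 (i - i') ?_
  funext a
  rw [show a + (i - i') = i + (a - i') by abel, heq, add_sub_cancel]

theorem isPrimitiveWord_indicator {m : ℕ} {C : Type*} {c₀ c₁ : C} (hc : c₀ ≠ c₁) :
    IsPrimitiveWord fun i : ZMod m => if i = 0 then c₁ else c₀ := by
  intro a ha
  by_contra h
  have := congrFun ha 0
  simp [h, hc] at this

/-- Every vertex of the graph of primitive necklaces is connected to the constant vertex. -/
theorem reflTransGen_mk_const {m p : ℕ} {C : Type*} {c₀ c₁ : C} (hc : c₀ ≠ c₁)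
    (v : ZMod m → Fin p → C) :
    Relation.ReflTransGen
      (fun r s => ∃ g : PrimitiveNecklace m (Fin (p + 1) → C), g.source = r ∧ g.target = s)
      (Quotient.mk (rotationSetoid m (Fin p → C)) v) (Quotient.mk _ fun _ _ => c₀) := by
  -- The columns of `v`, then one indicator column, then constants. Each window used as an edge
  -- contains column `p`, which alone makes it primitive.
  let col (b : ℕ) (i : ZMod m) : C :=
    if h : b < p then v i ⟨b, h⟩ else if b = p then (if i = 0 then c₁ else c₀) else c₀
  have key : ∀ j ≤ p + 1, Relation.ReflTransGen
      (fun r s => ∃ g : PrimitiveNecklace m (Fin (p + 1) → C), g.source = r ∧ g.target = s)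
      (Quotient.mk (rotationSetoid m (Fin p → C)) v)
      (Quotient.mk _ fun i b => col (j + (b : ℕ)) i) := by
    intro j
    induction j with
    | zero =>
      intro _
      have : (fun i (b : Fin p) => col (0 + (b : ℕ)) i) = v := by
        funext i b
        simp [col]
      rw [this]
    | succ j ih =>
      intro hj
      have hprim : IsPrimitiveWord fun i (b : Fin (p + 1)) => col (j + (b : ℕ)) i := by
        refine IsPrimitiveWord.of_comp (fun v => v ⟨p - j, by omega⟩) ?_
        convert isPrimitiveWord_indicator (m := m) hc using 2 with i
        simp [col, show j + (p - j) = p by omega]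
      refine (ih (by omega)).tail ⟨hprim.necklace, rfl, ?_⟩
      rw [PrimitiveNecklace.target, IsPrimitiveWord.map_necklace]
      congr 1
      funext i b
      simp only [Function.comp_apply, Fin.val_succ]
      rw [add_right_comm, add_assoc]
  convert key (p + 1) le_rfl using 2
  funext i b
  simp only [col]
  rw [dif_neg (by omega), if_neg (by omega)]

/-- There is a cyclic array with `m` rows, all of whose `m × (p + 1)` windows are distinct, and
with as many columns as there are primitive necklaces, up to a defect `c ≤ m`. -/
theorem exists_cyclic_array {C : Type*} [Fintype C] [Nontrivial C] (m p c : ℕ) (hm : 0 < m)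
    (hp : 0 < p) (hcm : c ≤ m) :
    ∃ t : ℕ, 0 < t ∧ (t : ℤ) + c = necklacePoly (Fintype.card C ^ (p + 1)) m ∧
      ∃ x : ZMod t → ZMod m → C, ∀ j j' i i',
        (∀ b ≤ p, ∀ a : ZMod m, x (j + (b : ℕ)) (i + a) = x (j' + (b : ℕ)) (i' + a)) →
          j = j' ∧ i = i' := by
  classical
  have : NeZero m := ⟨hm.ne'⟩
  obtain ⟨c₀, c₁, hc⟩ := exists_pair_ne C
  have : Fintype (PrimitiveNecklace m (Fin (p + 1) → C)) := Fintype.ofFinite _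
  let y (i : ZMod m) : C := if i = 0 then c₁ else c₀
  have hy : ∀ i, y i = c₁ → i = 0 := fun i hi => by
    by_contra h
    exact hc (by simpa [y, h] using hi)
  have hy0 : y 0 = c₁ := if_pos rfl
  have hyp : IsPrimitiveWord y := isPrimitiveWord_indicator hc
  -- Each column is the previous one shifted by `a`, so dropping the first or the last column gives
  -- rotations of one word: a loop.
  have hloop (a : ZMod m) :
      IsPrimitiveWord fun i (b : Fin (p + 1)) => y (i + ((b : ℕ) : ZMod m) * a) := by
    refine IsPrimitiveWord.of_comp (fun v => v 0) ?_
    convert hyp using 1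
    funext i
    simp
  have hinj : Function.Injective fun a => (hloop a).necklace := by
    intro a a' h
    obtain ⟨d, hd⟩ := (IsPrimitiveWord.necklace_eq_iff _ _).1 h
    -- Column `0` forces the rotation `d` to vanish; column `1`, present since `p > 0`, then
    -- recovers `a`.
    have h0 := congrFun (congrFun hd 0) 0
    have h1 := congrFun (congrFun hd (-a')) ⟨1, by omega⟩
    simp only [Fin.val_zero, Nat.cast_zero, zero_mul, add_zero, zero_add, Nat.cast_one, one_mul,
      neg_add_cancel, hy0] at h0 h1
    have h0 := hy _ h0.symm
    have h1 := hy _ h1.symm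
    rw [h0, add_zero, neg_add_eq_zero] at h1
    exact h1.symm
  obtain ⟨L, hLsub, hLcard⟩ := Finset.exists_subset_card_eq
    (s := Finset.univ.image fun a => (hloop a).necklace) (n := c) (by
      rwa [Finset.card_image_of_injective _ hinj, Finset.card_univ, ZMod.card])
  have hL : ∀ e ∈ L, e.source = e.target := by
    intro e he
    obtain ⟨a, -, rfl⟩ := Finset.mem_image.1 (hLsub he)
    refine Quotient.sound ⟨a, ?_⟩
    funext i b
    simp only [Function.comp_apply, Fin.val_succ, Fin.val_castSucc]
    congr 1
    push_cast
    ring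
  -- A base edge that ends at the constant vertex but does not start there, hence is not a loop.
  have hprim₀ : IsPrimitiveWord fun i (b : Fin (p + 1)) => if b = 0 then y i else c₀ := by
    refine IsPrimitiveWord.of_comp (fun v => v 0) ?_
    convert hyp using 1
    funext i
    simp
  have htgt : hprim₀.necklace.target = Quotient.mk _ fun _ _ => c₀ := by
    rw [PrimitiveNecklace.target, IsPrimitiveWord.map_necklace]
    congr 1
  have he₀ : hprim₀.necklace ∉ L := by
    intro h
    have h1 := hL _ h
    rw [htgt] at h1
    have h2 := congrFun (congrFun (eq_const_of_mk_eq h1) 0) ⟨0, hp⟩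
    simp only [Function.comp_apply] at h2
    rw [if_pos (by rfl), hy0] at h2
    exact hc h2.symm
  obtain ⟨t, u, ht, hcard, hu0, hut, hu, huinj⟩ := exists_eulerian_sequence
    PrimitiveNecklace.source PrimitiveNecklace.target
    (PrimitiveNecklace.congr ((finRotate (p + 1)).symm.arrowCongr (Equiv.refl C)))
    PrimitiveNecklace.source_congr_finRotate L hL hprim₀.necklace he₀ (by
      intro e
      rw [htgt]
      obtain ⟨f, hf, rfl⟩ := e.exists_rep
      exact reflTransGen_mk_const hc _)
  refine ⟨t, ht, ?_, exists_cyclic_array_of_walk u hu (fun _ => c₀) (hu0.trans htgt) ht hut huinj⟩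
  have h := card_primitiveNecklace (K := Fin (p + 1) → C) m hm
  rw [Fintype.card_fun, Fintype.card_fin, Nat.card_eq_fintype_card, ← hcard, hLcard] at h
  rw [← h]
  push_cast
  ring

/-! ### Combining two arrays, and the choice of coprime periods -/

theorem eq_of_castHom_eq {m s : ℕ} (h : m.Coprime s) {i i' : ZMod (m * s)}
    (h1 : ZMod.castHom (Dvd.intro s rfl) (ZMod m) i = ZMod.castHom (Dvd.intro s rfl) (ZMod m) i')
    (h2 : ZMod.castHom (Dvd.intro_left m rfl) (ZMod s) i =
      ZMod.castHom (Dvd.intro_left m rfl) (ZMod s) i') : i = i' := by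
  apply (ZMod.chineseRemainder h).injective
  refine Prod.ext ?_ ?_
  · simpa [ZMod.chineseRemainder, ZMod.cast_eq_val] using h1
  · simpa [ZMod.chineseRemainder, ZMod.cast_eq_val] using h2

/-- Two cyclic arrays with distinct windows, extended periodically in the two directions,
combine to a sub-perfect map. -/
theorem existsSubPerfectMap_of_cyclic_arrays {m n s t k₁ k₂ : ℕ} (hm : 0 < m) (hn : 0 < n)
    (hs : 0 < s) (ht : 0 < t) (hms : m.Coprime s) (hnt : n.Coprime t)
    (x : ZMod t → ZMod m → Fin k₁) (y : ZMod s → ZMod n → Fin k₂)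
    (hx : ∀ j j' i i', (∀ b < n, ∀ a : ZMod m,
      x (j + (b : ℕ)) (i + a) = x (j' + (b : ℕ)) (i' + a)) → j = j' ∧ i = i')
    (hy : ∀ i i' j j', (∀ a < m, ∀ b : ZMod n,
      y (i + (a : ℕ)) (j + b) = y (i' + (a : ℕ)) (j' + b)) → i = i' ∧ j = j') :
    ExistsSubPerfectMap (m * s) (n * t) m n (k₁ * k₂) := by
  have : NeZero m := ⟨hm.ne'⟩
  have : NeZero n := ⟨hn.ne'⟩
  refine ⟨Nat.mul_pos hm hs, Nat.mul_pos hn ht, fun i j => finProdFinEquiv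
    (x (ZMod.castHom (Dvd.intro_left n rfl) (ZMod t) j) (ZMod.castHom (Dvd.intro s rfl) (ZMod m) i),
      y (ZMod.castHom (Dvd.intro_left m rfl) (ZMod s) i)
        (ZMod.castHom (Dvd.intro t rfl) (ZMod n) j)), ?_⟩
  intro P i i' j j' h h'
  have key := fun (a : Fin m) (b : Fin n) =>
    Prod.ext_iff.1 (finProdFinEquiv.injective ((h a b).trans (h' a b).symm))
  simp only [map_add, map_natCast] at key
  -- The `m` rows of a pattern cover a full vertical period of `x`, so the windows agree at every `a
  -- : ZMod m`.
  have h1 := hx _ _ _ _ fun b hb a => by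
    have := (key ⟨a.val, ZMod.val_lt a⟩ ⟨b, hb⟩).1
    simpa only [ZMod.natCast_zmod_val] using this
  have h2 := hy _ _ _ _ fun a ha b => by
    have := (key ⟨a, ha⟩ ⟨b.val, ZMod.val_lt b⟩).2
    simpa only [ZMod.natCast_zmod_val] using this
  exact ⟨eq_of_castHom_eq hms h1.2 h2.1, eq_of_castHom_eq hnt h2.2 h1.1⟩

theorem columnCorrection_nonneg (a : ℤ) (n : ℕ) : 0 ≤ columnCorrection a n := by
  unfold columnCorrection
  positivity

/-- Residue `0` gives `1`; the largest other corrected residue, `n - 2`, gives `n - 3`. -/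
theorem columnCorrection_le (a : ℤ) {n : ℕ} (hn : 2 ≤ n) :
    columnCorrection a n ≤ max 1 ((n : ℤ) - 3) := by
  have := Int.emod_nonneg a (show (n : ℤ) ≠ 0 by omega)
  unfold columnCorrection
  split_ifs with h
  · rw [mul_one]
    rcases abs_cases (a % (n : ℤ) - 1) with h' | h' <;> omega
  · simp

/-- The correction lowers `a` to the nearest integer congruent to `±1` modulo `n`. -/
theorem isCoprime_sub_columnCorrection (a : ℤ) {n : ℕ} (hn : 2 ≤ n) :
    IsCoprime (n : ℤ) (a - columnCorrection a n) := by
  have h0 := Int.emod_nonneg a (show (n : ℤ) ≠ 0 by omega)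
  have h1 := Int.emod_lt_of_pos a (show 0 < (n : ℤ) by omega)
  have h2 := Int.emod_add_mul_ediv a n
  have h3 : a - columnCorrection a n = 1 + n * (a / n) ∨
      a - columnCorrection a n = -1 + n * (a / n) ∨
      a - columnCorrection a n = -1 + n * (a / n + 1) := by
    unfold columnCorrection
    rw [mul_add]
    split_ifs with h
    · rcases abs_cases (a % (n : ℤ) - 1) with h' | h' <;> omega
    · omega
  rcases h3 with h3 | h3 | h3 <;> rw [h3, IsCoprime.add_mul_left_right_iff]
  · exact isCoprime_one_right
  · exact isCoprime_one_right.neg_right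
  · exact isCoprime_one_right.neg_right

/-- The bound `n ≤ m + 2` gives `max 1 (n - 3) ≤ m`, so the `m` known loops suffice for the
correction. -/
theorem exists_cyclic_array_columnCorrection {k m n : ℕ} (hk : 2 ≤ k) (hm : 2 ≤ m) (hn : 2 ≤ n)
    (hmn : n ≤ m + 2) :
    ∃ t : ℕ, 0 < t ∧ n.Coprime t ∧
      (t : ℤ) = necklacePoly (k ^ n) m - columnCorrection (necklacePoly (k ^ n) m) n ∧
      ∃ x : ZMod t → ZMod m → Fin k, ∀ j j' i i',
        (∀ b < n, ∀ a : ZMod m, x (j + (b : ℕ)) (i + a) = x (j' + (b : ℕ)) (i' + a)) →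
          j = j' ∧ i = i' := by
  obtain ⟨p, rfl⟩ : ∃ p, n = p + 1 := ⟨n - 1, by omega⟩
  obtain ⟨c, hc⟩ := Int.eq_ofNat_of_zero_le
    (columnCorrection_nonneg (necklacePoly (k ^ (p + 1)) m) (p + 1))
  have hle := columnCorrection_le (necklacePoly (k ^ (p + 1)) m) hn
  have : Nontrivial (Fin k) := Fin.nontrivial_iff_two_le.2 hk
  obtain ⟨t, ht, hcard, x, hx⟩ := exists_cyclic_array (C := Fin k) m p c (by omega) (by omega)
    (by omega)
  rw [Fintype.card_fin] at hcard
  have hteq : (t : ℤ) = necklacePoly (k ^ (p + 1)) m -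
      columnCorrection (necklacePoly (k ^ (p + 1)) m) (p + 1) := by
    rw [hc, ← hcard]
    simp
  refine ⟨t, ht, ?_, hteq, x, fun j j' i i' h => hx j j' i i' fun b hb => h b (by omega)⟩
  rw [← Nat.isCoprime_iff_coprime, hteq]
  exact isCoprime_sub_columnCorrection _ hn

theorem theorem2 (k₁ k₂ m n : ℕ) (hk₁ : 2 ≤ k₁) (hk₂ : 2 ≤ k₂) (hm : 2 ≤ m) (hn : 2 ≤ n)
    (hmn : |(m : ℤ) - (n : ℤ)| ≤ 2) :
    ∃ M N : ℕ,
      ExistsSubPerfectMap M N m n (k₁ * k₂) ∧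
      (M : ℤ) = m * (necklacePoly (k₂ ^ m) n - columnCorrection (necklacePoly (k₂ ^ m) n) m) ∧
      (M : ℤ) ≥ m * (necklacePoly (k₂ ^ m) n - max 1 ((m : ℤ) - 3)) ∧
      (N : ℤ) = n * (necklacePoly (k₁ ^ n) m - columnCorrection (necklacePoly (k₁ ^ n) m) n) ∧
      (N : ℤ) ≥ n * (necklacePoly (k₁ ^ n) m - max 1 ((n : ℤ) - 3)) := by
  rw [abs_le] at hmn
  obtain ⟨t, ht, hnt, hteq, x, hx⟩ := exists_cyclic_array_columnCorrection hk₁ hm hn (by omega)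
  obtain ⟨s, hs, hms, hseq, y, hy⟩ := exists_cyclic_array_columnCorrection hk₂ hn hm (by omega)
  refine ⟨m * s, n * t, existsSubPerfectMap_of_cyclic_arrays (by omega) (by omega) hs ht hms hnt
    x y hx hy, ?_, ?_, ?_, ?_⟩
  · rw [Nat.cast_mul, hseq]
  · rw [Nat.cast_mul, hseq]
    have := columnCorrection_le (necklacePoly (k₂ ^ m) n) hm
    gcongr
  · rw [Nat.cast_mul, hteq]
  · rw [Nat.cast_mul, hteq]
    have := columnCorrection_le (necklacePoly (k₁ ^ n) m) hn
    gcongr
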